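/- Let $G\subset\mathbb{R}^d$ be a bounded Borel set with $\mathrm{vol}_d(G)\ge 1$, let $C\ge 1$ be a real number and $n\ge 1$ an integer, and let $\mu_G(A)=\mathrm{vol}_d(A)/\mathrm{vol}_d(G)$ be the uniform distribution on $G$. For a Borel measurable $\rho\colon G\to(0,\infty)$ with $1\le\rho(x)\le C$ for all $x\in G$, define the distribution $$\pi_\rho(A)=\frac{\int_A\rho(x)\,dx}{\int_G\rho(x)\,dx},\qquad A\in\mathcal{B}(G),$$ and the transition kernel of the (independent) Metropolis algorithm with proposal $\mu_G$, $$K_\rho(x,A)=\int_A\alpha(x,y)\,\mu_G(dy)+\mathbf{1}_A(x)\Bigl(1-\int_G\alpha(x,y)\,\mu_G(dy)\Bigr),\qquad \alpha(x,y)=\min\{1,\rho(y)/\rho(x)\}.$$ Let $$n_0=\lceil C\,\mathrm{vol}_d(G)\,\log(2C)\rceil .$$ Then for every such $\rho$, every $f\in L_2(\pi_\rho)$ with $\|f\|_{L_2(\pi_\rho)}\le 1$, and every Markov chain $X_1,X_2,\dots$ with transition kernel $K_\rho$ and initial distribution $\mu_G$, $$\mathbb{E}\,\Bigl|\frac1n\sum_{j=1}^n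 f(X_{j+n_0})-\int_G f\,d\pi_\rho\Bigr|^2\le\frac{2\,C\,\mathrm{vol}_d(G)}{n}+\frac{4\,C^2\,\mathrm{vol}_d(G)^2}{n^2}.$$ -/

import Mathlib

open MeasureTheory ProbabilityTheory

noncomputable section

namespace MCMC

/-- Lebesgue measure on `G ⊆ ℝ^d`, as a measure on the subtype `G`. -/
def lebesgueOn {d : ℕ} (G : Set (EuclideanSpace ℝ (Fin d))) : Measure G :=
  (volume : Measure (EuclideanSpace ℝ (Fin d))).comap Subtype.val

/-- The uniform distribution `μ_G(A) = vol_d(A) / vol_d(G)` on `G`. -/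
def uniformMeasure {d : ℕ} (G : Set (EuclideanSpace ℝ (Fin d))) : Measure G :=
  (volume G)⁻¹ • lebesgueOn G

instance instIsFiniteMeasureUniformMeasure {d : ℕ} (G : Set (EuclideanSpace ℝ (Fin d))) :
    IsFiniteMeasure (uniformMeasure G) where
  measure_univ_lt_top := by
    have h : lebesgueOn G Set.univ ≤ volume G :=
      (Measure.comap_apply_le _ _ nullMeasurableSet_univ).trans (by simp)
    calc uniformMeasure G Set.univ ≤ (volume G)⁻¹ * volume G := by
          simp only [uniformMeasure, Measure.smul_apply, smul_eq_mul]
          gcongr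
      _ ≤ 1 := ENNReal.inv_mul_le_one _
      _ < ⊤ := ENNReal.one_lt_top

/-- The distribution `π_ρ(A) = ∫_A ρ dx / ∫_G ρ dx` on `G`, for an unnormalized density `ρ`. -/
def targetMeasure {d : ℕ} (G : Set (EuclideanSpace ℝ (Fin d))) (ρ : G → ℝ) : Measure G :=
  (∫⁻ x, ENNReal.ofReal (ρ x) ∂(lebesgueOn G))⁻¹ •
    (lebesgueOn G).withDensity (fun x => ENNReal.ofReal (ρ x))

/-- The acceptance probability `α(x, y) = min {1, ρ(y) / ρ(x)}`. -/
def acceptance {α : Type*} (ρ : α → ℝ) (x y : α) : ℝ := min 1 (ρ y / ρ x)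

theorem measurable_acceptance {α : Type*} [MeasurableSpace α] {ρ : α → ℝ} (hρ : Measurable ρ) :
    Measurable (Function.uncurry fun x y => ENNReal.ofReal (acceptance ρ x y)) := by
  unfold acceptance Function.uncurry
  fun_prop

/-- The transition kernel of the Metropolis algorithm with proposal kernel `Q`:
`K_ρ(x, A) = ∫_A α(x, y) Q(x, dy) + 1_A(x) (1 - ∫ α(x, y) Q(x, dy))`. -/
def metropolisKernel {α : Type*} [MeasurableSpace α] (Q : Kernel α α) [IsSFiniteKernel Q]
    (ρ : α → ℝ) (hρ : Measurable ρ) : Kernel α α where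
  toFun x :=
    (Q x).withDensity (fun y => ENNReal.ofReal (acceptance ρ x y)) +
      (1 - ∫⁻ y, ENNReal.ofReal (acceptance ρ x y) ∂(Q x)) • Measure.dirac x
  measurable' := by
    have h := measurable_acceptance hρ
    have hx : ∀ x, Measurable fun y => ENNReal.ofReal (acceptance ρ x y) := fun x =>
      h.comp measurable_prodMk_left
    refine Measure.measurable_of_measurable_coe _ fun A hA => ?_
    simp only [Measure.add_apply, Measure.smul_apply, smul_eq_mul, withDensity_apply _ hA,
      Measure.dirac_apply' _ hA]
    exact (Measurable.setLIntegral_kernel_prod_right h hA).add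
      ((measurable_const.sub (Measurable.lintegral_kernel_prod_right h)).mul
        (measurable_one.indicator hA))

/-- `X` is, under the probability measure `P`, a Markov chain with transition kernel `K` and
initial distribution `ν`. The chain is indexed from `0`: `X i` is the `(i + 1)`-st state, so the
states `X_1, X_2, …` are here `X 0, X 1, …`, and `X 0` has distribution `ν`. -/
structure IsMarkovChain {α Ω : Type*} [MeasurableSpace α] [MeasurableSpace Ω]
    (P : Measure Ω) (K : Kernel α α) (ν : Measure α) (X : ℕ → Ω → α) : Prop where
  measurable : ∀ i, Measurable (X i)
  map_zero : P.map (X 0) = ν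
  condExp_succ : ∀ (i : ℕ) (A : Set α), MeasurableSet A →
    P[(X (i + 1) ⁻¹' A).indicator (fun _ => (1 : ℝ)) |
        ⨆ j ∈ Set.Iic i, MeasurableSpace.comap (X j) inferInstance]
      =ᵐ[P] fun ω => (K (X i ω)).real A

/-- The estimator `S_{n,n₀}(f) = (1/n) ∑_{j=1}^n f(X_{j+n₀})`; with the chain indexed from `0`,
the state `X_{j+1+n₀}` is `X (j + n₀)`. -/
def estimator {α Ω : Type*} (X : ℕ → Ω → α) (f : α → ℝ) (n n₀ : ℕ) (ω : Ω) : ℝ :=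
  (1 / (n : ℝ)) * ∑ j ∈ Finset.range n, f (X (j + n₀) ω)

/-- The squared error `e_ν(S_{n,n₀}, f)² = 𝔼 |S_{n,n₀}(f) - ∫ f dπ|²`, with values in `[0, ∞]`. -/
def meanSquareError {α Ω : Type*} [MeasurableSpace α] [MeasurableSpace Ω]
    (P : Measure Ω) (X : ℕ → Ω → α) (π : Measure α) (f : α → ℝ) (n n₀ : ℕ) : ENNReal :=
  ∫⁻ ω, ENNReal.ofReal (|estimator X f n n₀ ω - ∫ x, f x ∂π| ^ 2) ∂P

end MCMC

end

/-!
The independent Metropolis chain is uniformly ergodic: since `α(x, y) ≥ ρ y / C` and the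
normalization of `ρ` with respect to the uniform distribution is at least `1`, every `K x` dominates
`ε • π` with `ε = 1 / C`, where `π` is the target (`minorization_metropolisKernel_const`). Moreover
`π` is invariant by detailed balance (`isReversible_metropolisKernel_const`).

The minorization is used twice.

* The Markov operator contracts centred functions in `L²(π)` by the factor `1 - ε`
  (`markovOp_contraction`): a centred `g` integrates to the same value against `K x` and against
  `K x - ε • π`, whose mass is only `1 - ε`.
* The law of `X i` is at most `(1 + M (1 - ε) ^ i) • π` when the initial law is at most
  `(1 + M) • π` (`IsMarkovChain.map_le_smul`); here `M = C - 1`.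

For `g = f - ∫ f dπ` the Markov property gives `𝔼 g(X_i) g(X_{i+k}) = 𝔼 (g * K^k g)(X_i)`.
Bounding the law of `X i` by a multiple of `π` and applying Cauchy–Schwarz in `L²(π)`, this is at
most `(1 + M (1 - ε) ^ i) (1 - ε) ^ k` (`IsMarkovChain.integral_mul_le`). No density of the law of
`X i`, and no spectral theory, is needed. Summing the geometric series over all pairs of times
yields `(2 / ε - 1) (n + M (1 - ε) ^ n₀ / ε) / n²` (`IsMarkovChain.meanSquareError_le`), and the
burn-in `n₀ ≥ C log (2C)` makes `(1 - ε) ^ n₀ ≤ 1 / (2C)`. As `vol G ≥ 1`, the bound so obtained,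
`2C / n + C² / n²`, is at most the asserted one.
-/

namespace MCMC

/-! ### Integrals and domination of measures -/

section Integration

variable {α : Type*} [MeasurableSpace α]

theorem integral_abs_mul_le_sqrt_mul_sqrt {μ : Measure α} {g h : α → ℝ}
    (hg : MemLp g 2 μ) (hh : MemLp h 2 μ) :
    ∫ x, |g x * h x| ∂μ ≤ √(∫ x, g x ^ 2 ∂μ) * √(∫ x, h x ^ 2 ∂μ) := by
  have h2 : ENNReal.ofReal 2 = 2 := by simp
  have := integral_mul_le_Lp_mul_Lq_of_nonneg (μ := μ) Real.HolderConjugate.two_two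
    (f := fun x => |g x|) (g := fun x => |h x|)
    (.of_forall fun _ => abs_nonneg _) (.of_forall fun _ => abs_nonneg _)
    (by rw [h2]; exact hg.abs) (by rw [h2]; exact hh.abs)
  simpa [abs_mul, Real.sqrt_eq_rpow] using this

theorem sq_integral_le_measureReal_mul {μ : Measure α} [IsFiniteMeasure μ] {g : α → ℝ}
    (hg : MemLp g 2 μ) : (∫ x, g x ∂μ) ^ 2 ≤ μ.real Set.univ * ∫ x, g x ^ 2 ∂μ := by
  have h := integral_abs_mul_le_sqrt_mul_sqrt (memLp_const (1 : ℝ)) hg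
  simp only [one_mul, one_pow, integral_const, smul_eq_mul, mul_one] at h
  have h0 : 0 ≤ ∫ x, g x ^ 2 ∂μ := integral_nonneg fun _ => sq_nonneg _
  calc (∫ x, g x ∂μ) ^ 2 = |∫ x, g x ∂μ| ^ 2 := (sq_abs _).symm
    _ ≤ (√(μ.real Set.univ) * √(∫ x, g x ^ 2 ∂μ)) ^ 2 := by
        gcongr
        exact abs_integral_le_integral_abs.trans h
    _ = _ := by rw [mul_pow, Real.sq_sqrt measureReal_nonneg, Real.sq_sqrt h0]

theorem integral_comp_measure {β : Type*} [MeasurableSpace β] {κ : Kernel α β} {μ : Measure α}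
    {F : β → ℝ} (hF : Integrable F (κ ∘ₘ μ)) :
    ∫ y, F y ∂(κ ∘ₘ μ) = ∫ x, ∫ y, F y ∂(κ x) ∂μ := by
  rw [Measure.comp_eq_comp_const_apply] at hF ⊢
  simpa using Kernel.integral_comp hF

theorem integral_le_of_measure_le_smul {μ ν : Measure α} {c : ℝ} (hc : 0 ≤ c)
    (hνμ : ν ≤ ENNReal.ofReal c • μ) {F : α → ℝ} (hF0 : ∀ x, 0 ≤ F x) (hF : Integrable F μ) :
    ∫ x, F x ∂ν ≤ c * ∫ x, F x ∂μ := by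
  refine (integral_mono_measure hνμ (.of_forall hF0)
    (hF.smul_measure ENNReal.ofReal_ne_top)).trans ?_
  rw [integral_smul_measure, ENNReal.toReal_ofReal hc, smul_eq_mul]

end Integration

/-! ### Markov operators of minorized kernels -/

section Doeblin

variable {α : Type*} [MeasurableSpace α] {K : Kernel α α} {π : Measure α} {ε : ℝ}

/-- The Markov operator of the kernel `K` acting on functions, `(K g)(x) = ∫ g(y) K(x, dy)`. -/
noncomputable def markovOp (K : Kernel α α) (g : α → ℝ) (x : α) : ℝ := ∫ y, g y ∂(K x)

theorem measurable_markovOp {g : α → ℝ} (hg : Measurable g) : Measurable (markovOp K g) :=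
  (hg.stronglyMeasurable.integral_kernel (κ := K)).measurable

theorem integral_markovOp (hinv : K.Invariant π) {g : α → ℝ} (hg : Integrable g π) :
    ∫ x, markovOp K g x ∂π = ∫ x, g x ∂π := by
  have h := hinv.def
  conv_rhs => rw [← h]
  rw [← h] at hg
  exact (integral_comp_measure hg).symm

theorem ae_integrable_kernel (hinv : K.Invariant π) {g : α → ℝ} (hg : Integrable g π) :
    ∀ᵐ x ∂π, Integrable g (K x) := by
  rw [← hinv.def] at hg
  exact Measure.ae_integrable_of_integrable_comp hg

theorem integrable_markovOp (hinv : K.Invariant π) {g : α → ℝ} (hg : Integrable g π)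
    (hgm : Measurable g) : Integrable (markovOp K g) π := by
  rw [← hinv.def] at hg
  refine (Measure.integrable_integral_norm_of_integrable_comp hg).mono'
    (measurable_markovOp hgm).aestronglyMeasurable (.of_forall fun x => ?_)
  exact norm_integral_le_integral_norm _

/-- A centred function integrates to `0` against the part `ε • π` of `κ`, so Cauchy–Schwarz may be
applied to the remainder `κ - ε • π`, of mass `1 - ε`. -/
theorem sq_integral_le_of_minorization {κ π : Measure α} [IsProbabilityMeasure κ]
    [IsProbabilityMeasure π] (hε : 0 ≤ ε) (hκ : ENNReal.ofReal ε • π ≤ κ) {g : α → ℝ}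
    (hg : MemLp g 2 κ) (hgπ : MemLp g 2 π) (h0 : ∫ x, g x ∂π = 0) :
    (∫ x, g x ∂κ) ^ 2 ≤ (1 - ε) * (∫ x, g x ^ 2 ∂κ - ε * ∫ x, g x ^ 2 ∂π) := by
  have : IsFiniteMeasure (ENNReal.ofReal ε • π) := π.smul_finite ENNReal.ofReal_ne_top
  set l := κ - ENNReal.ofReal ε • π
  have hsum : l + ENNReal.ofReal ε • π = κ := Measure.sub_add_cancel_of_le hκ
  have hlκ : l ≤ κ := Measure.sub_le
  have : IsFiniteMeasure l := isFiniteMeasure_of_le κ hlκ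
  have hsplit : ∀ F : α → ℝ, Integrable F κ → Integrable F π →
      ∫ x, F x ∂κ = ∫ x, F x ∂l + ε * ∫ x, F x ∂π := fun F hF hFπ => by
    rw [← hsum, integral_add_measure (hF.mono_measure hlκ)
      (hFπ.smul_measure ENNReal.ofReal_ne_top), integral_smul_measure,
      ENNReal.toReal_ofReal hε, smul_eq_mul]
  have h1 := hsplit (fun _ => 1) (integrable_const _) (integrable_const _)
  have hgi := hsplit g (hg.integrable one_le_two) (hgπ.integrable one_le_two)
  have hg2 := hsplit _ hg.integrable_sq hgπ.integrable_sq
  simp only [integral_const, probReal_univ, smul_eq_mul, mul_one] at h1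
  rw [h0, mul_zero, add_zero] at hgi
  rw [hgi, hg2, add_sub_cancel_right, h1, add_sub_cancel_right]
  exact sq_integral_le_measureReal_mul (hg.mono_measure hlκ)

variable [IsProbabilityMeasure π]

/-- Under the minorization `ε • π ≤ K x`, the Markov operator contracts centred functions in
`L²(π)` by the factor `1 - ε`. -/
theorem markovOp_contraction [IsMarkovKernel K] (hinv : K.Invariant π)
    (hε : 0 ≤ ε)
    (hmin : ∀ x, ENNReal.ofReal ε • π ≤ K x) {g : α → ℝ} (hgm : Measurable g)
    (hg : MemLp g 2 π) (h0 : ∫ x, g x ∂π = 0) :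
    MemLp (markovOp K g) 2 π ∧
      ∫ x, markovOp K g x ^ 2 ∂π ≤ (1 - ε) ^ 2 * ∫ x, g x ^ 2 ∂π := by
  have hbound : ∀ᵐ x ∂π, markovOp K g x ^ 2 ≤
      (1 - ε) * (markovOp K (fun y => g y ^ 2) x - ε * ∫ x, g x ^ 2 ∂π) := by
    filter_upwards [ae_integrable_kernel hinv hg.integrable_sq] with x hx
    exact sq_integral_le_of_minorization hε (hmin x)
      ((memLp_two_iff_integrable_sq hgm.aestronglyMeasurable).2 hx) hg h0
  have hi := integrable_markovOp hinv hg.integrable_sq (hgm.pow_const 2)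
  have hi' : Integrable
      (fun x => (1 - ε) * (markovOp K (fun y => g y ^ 2) x - ε * ∫ x, g x ^ 2 ∂π)) π :=
    (hi.sub (integrable_const _)).const_mul _
  have hsq : Integrable (fun x => markovOp K g x ^ 2) π := by
    refine hi'.mono' ((measurable_markovOp hgm).pow_const 2).aestronglyMeasurable ?_
    filter_upwards [hbound] with x hx
    rwa [Real.norm_of_nonneg (sq_nonneg _)]
  refine ⟨(memLp_two_iff_integrable_sq (measurable_markovOp hgm).aestronglyMeasurable).2 hsq, ?_⟩
  refine (integral_mono_ae hsq hi' hbound).trans_eq ?_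
  rw [integral_const_mul, integral_sub hi (integrable_const _),
    integral_markovOp hinv hg.integrable_sq, integral_const, probReal_univ, one_smul]
  ring

theorem markovOp_iterate_contraction [IsMarkovKernel K] (hinv : K.Invariant π)
    (hε : 0 ≤ ε)
    (hmin : ∀ x, ENNReal.ofReal ε • π ≤ K x) {g : α → ℝ} (hgm : Measurable g)
    (hg : MemLp g 2 π) (h0 : ∫ x, g x ∂π = 0) (k : ℕ) :
    Measurable ((markovOp K)^[k] g) ∧ MemLp ((markovOp K)^[k] g) 2 π ∧
      ∫ x, (markovOp K)^[k] g x ∂π = 0 ∧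
      ∫ x, (markovOp K)^[k] g x ^ 2 ∂π ≤ ((1 - ε) ^ k) ^ 2 * ∫ x, g x ^ 2 ∂π := by
  induction k with
  | zero => simp [hgm, hg, h0]
  | succ k ih =>
    obtain ⟨hm, hL, hz, hb⟩ := ih
    rw [Function.iterate_succ_apply']
    obtain ⟨hL', hb'⟩ := markovOp_contraction hinv hε hmin hm hL hz
    refine ⟨measurable_markovOp hm, hL', ?_, hb'.trans ?_⟩
    · rw [integral_markovOp hinv (hL.integrable one_le_two), hz]
    · calc _ ≤ (1 - ε) ^ 2 * (((1 - ε) ^ k) ^ 2 * ∫ x, g x ^ 2 ∂π) := by gcongr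
        _ = _ := by ring

/-- One step of the kernel pulls the law towards `π`: the excess `M` of the density bound shrinks by
the factor `1 - ε`. -/
theorem comp_le_smul_of_le_smul (hinv : K.Invariant π) (hε : 0 ≤ ε) (hε1 : ε ≤ 1)
    (hmin : ∀ x, ENNReal.ofReal ε • π ≤ K x) {ν : Measure α} [IsProbabilityMeasure ν] {M : ℝ}
    (hM : 0 ≤ M) (hν : ν ≤ ENNReal.ofReal (1 + M) • π) :
    K ∘ₘ ν ≤ ENNReal.ofReal (1 + M * (1 - ε)) • π := by
  refine Measure.le_iff.2 fun A hA => ?_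
  have hsplit : ∀ x, K x A = ENNReal.ofReal ε * π A + (K x A - ENNReal.ofReal ε * π A) :=
    fun x => (add_tsub_cancel_of_le (by simpa using hmin x A)).symm
  have hcomp : ∀ μ : Measure α, IsProbabilityMeasure μ → (K ∘ₘ μ) A =
      ENNReal.ofReal ε * π A + ∫⁻ x, (K x A - ENNReal.ofReal ε * π A) ∂μ := fun μ _ => by
    rw [Measure.bind_apply hA K.aemeasurable, lintegral_congr hsplit,
      lintegral_add_left measurable_const]
    simp
  have hπ := hcomp π inferInstance
  rw [hinv.def] at hπ
  have hle : ∫⁻ x, (K x A - ENNReal.ofReal ε * π A) ∂ν ≤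
      ENNReal.ofReal (1 + M) * ∫⁻ x, (K x A - ENNReal.ofReal ε * π A) ∂π := by
    refine (lintegral_mono' hν le_rfl).trans_eq ?_
    rw [lintegral_smul_measure, smul_eq_mul]
  rw [hcomp ν inferInstance, Measure.smul_apply, smul_eq_mul]
  set I := ∫⁻ x, (K x A - ENNReal.ofReal ε * π A) ∂π
  have hI : I ≠ ⊤ := ne_top_of_le_ne_top (measure_ne_top π A) (hπ ▸ le_add_self)
  have hIr : (π A).toReal = ε * (π A).toReal + I.toReal := by
    conv_lhs => rw [hπ]
    rw [ENNReal.toReal_add (by finiteness) hI, ENNReal.toReal_mul, ENNReal.toReal_ofReal hε]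
  refine (add_le_add le_rfl hle).trans_eq ?_
  have h1 : (0 : ℝ) ≤ 1 + M * (1 - ε) := by nlinarith [mul_nonneg hM (sub_nonneg.2 hε1)]
  rw [← ENNReal.ofReal_toReal (measure_ne_top π A), ← ENNReal.ofReal_toReal hI,
    ← ENNReal.ofReal_mul hε, ← ENNReal.ofReal_mul (by positivity), ← ENNReal.ofReal_mul h1,
    ← ENNReal.ofReal_add (by positivity) (by positivity)]
  congr 1
  have hIr' : I.toReal = (1 - ε) * (π A).toReal := by linarith
  rw [hIr']
  ring

end Doeblin

/-! ### Correlations along a Markov chain -/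

section Chain

variable {α Ω : Type*} [MeasurableSpace α] [mΩ : MeasurableSpace Ω] {P : Measure Ω}
  [IsProbabilityMeasure P] {K : Kernel α α} [IsMarkovKernel K] {ν : Measure α} {X : ℕ → Ω → α}

/-- The joint law of `(X i, X (j + 1))` arises from that of `(X i, X j)` by letting the second
component move according to `K`. -/
theorem IsMarkovChain.map_pair_succ (hX : IsMarkovChain P K ν X) {i j : ℕ} (hij : i ≤ j) :
    P.map (fun ω => (X i ω, X (j + 1) ω)) =
      (Kernel.id ∥ₖ K) ∘ₘ P.map (fun ω => (X i ω, X j ω)) := by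
  have hm : ∀ i j, Measurable fun ω => (X i ω, X j ω) := fun i j =>
    (hX.measurable i).prodMk (hX.measurable j)
  have : IsProbabilityMeasure (P.map fun ω => (X i ω, X (j + 1) ω)) :=
    Measure.isProbabilityMeasure_map (hm i (j + 1)).aemeasurable
  refine Measure.ext_prod fun {A B} hA hB => ?_
  have hXA : MeasurableSet (X i ⁻¹' A) := hX.measurable i hA
  have hXB : MeasurableSet (X (j + 1) ⁻¹' B) := hX.measurable (j + 1) hB
  rw [Measure.map_apply (hm i (j + 1)) (hA.prod hB),
    Measure.bind_apply (hA.prod hB) (Kernel.aemeasurable _),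
    lintegral_map (Kernel.measurable_coe _ (hA.prod hB)) (hm i j)]
  have hpre : (fun ω => (X i ω, X (j + 1) ω)) ⁻¹' A ×ˢ B = X (j + 1) ⁻¹' B ∩ X i ⁻¹' A := by
    ext ω; simp [and_comm]
  have hker : ∀ ω, (Kernel.id ∥ₖ K) (X i ω, X j ω) (A ×ˢ B) =
      (X i ⁻¹' A).indicator (fun ω => K (X j ω) B) ω := fun ω => by
    rw [Kernel.parallelComp_apply, Measure.prod_prod, Kernel.id_apply,
      Measure.dirac_apply' _ hA]
    by_cases h : X i ω ∈ A <;> simp [h]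
  rw [hpre, lintegral_congr hker, lintegral_indicator hXA]
  have hmle : ⨆ k ∈ Set.Iic j, MeasurableSpace.comap (X k) (inferInstance : MeasurableSpace α) ≤
      mΩ := iSup₂_le fun k _ => (hX.measurable k).comap_le
  have hXA' : MeasurableSet[⨆ k ∈ Set.Iic j, MeasurableSpace.comap (X k)
      (inferInstance : MeasurableSpace α)] (X i ⁻¹' A) :=
    le_iSup₂_of_le (f := fun k (_ : k ∈ Set.Iic j) =>
      MeasurableSpace.comap (X k) (inferInstance : MeasurableSpace α)) i hij le_rfl _ ⟨A, hA, rfl⟩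
  have hce := setIntegral_condExp hmle
    (f := (X (j + 1) ⁻¹' B).indicator fun _ => (1 : ℝ)) (μ := P)
    ((integrable_const _).indicator hXB) hXA'
  rw [setIntegral_congr_ae (g := fun ω => (K (X j ω)).real B) hXA
    ((hX.condExp_succ j B hB).mono fun ω h _ => h), integral_indicator hXB,
    setIntegral_const, smul_eq_mul, mul_one, measureReal_restrict_apply hXB] at hce
  have hreal : ∫ ω in X i ⁻¹' A, (K (X j ω)).real B ∂P =
      (∫⁻ ω in X i ⁻¹' A, K (X j ω) B ∂P).toReal :=
    integral_toReal ((K.measurable_coe hB).comp (hX.measurable j)).aemeasurable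
      (.of_forall fun _ => measure_lt_top _ _)
  rw [hreal] at hce
  refine ((ENNReal.toReal_eq_toReal_iff' ?_ (measure_ne_top _ _)).1 hce).symm
  refine ne_top_of_le_ne_top (measure_ne_top P (X i ⁻¹' A))
    ((lintegral_mono fun ω => prob_le_one).trans_eq (by simp))

theorem IsMarkovChain.map_succ (hX : IsMarkovChain P K ν X) (i : ℕ) :
    P.map (X (i + 1)) = K ∘ₘ P.map (X i) := by
  ext A hA
  have h := congrArg (fun μ => μ (Set.univ ×ˢ A)) (hX.map_pair_succ (le_refl i))
  beta_reduce at h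
  rw [Measure.map_apply ((hX.measurable i).prodMk (hX.measurable (i + 1)))
    (MeasurableSet.univ.prod hA), Measure.bind_apply (MeasurableSet.univ.prod hA)
      (Kernel.aemeasurable _), lintegral_map (Kernel.measurable_coe _ (MeasurableSet.univ.prod hA))
      ((hX.measurable i).prodMk (hX.measurable i))] at h
  rw [Measure.map_apply (hX.measurable _) hA, Measure.bind_apply hA K.aemeasurable,
    lintegral_map (K.measurable_coe hA) (hX.measurable i)]
  simpa only [Kernel.parallelComp_apply, Measure.prod_prod, measure_univ, one_mul,
    Set.mk_preimage_prod, Set.preimage_univ, Set.univ_inter] using h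

/-- The Markov property: given the past up to time `j`, the state `X (j + 1)` may be integrated out
against `K`. -/
theorem IsMarkovChain.integral_mul_succ (hX : IsMarkovChain P K ν X) {i j : ℕ} (hij : i ≤ j)
    {φ ψ : α → ℝ} (hφ : Measurable φ) (hψ : Measurable ψ)
    (hi : Integrable (fun ω => φ (X i ω) * ψ (X (j + 1) ω)) P) :
    ∫ ω, φ (X i ω) * ψ (X (j + 1) ω) ∂P = ∫ ω, φ (X i ω) * markovOp K ψ (X j ω) ∂P := by
  have hm : ∀ i j, Measurable fun ω => (X i ω, X j ω) := fun i j =>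
    (hX.measurable i).prodMk (hX.measurable j)
  have hF : Measurable fun p : α × α => φ p.1 * ψ p.2 := by fun_prop
  have hint : Integrable (fun p : α × α => φ p.1 * ψ p.2)
      (P.map fun ω => (X i ω, X (j + 1) ω)) :=
    (integrable_map_measure hF.aestronglyMeasurable (hm _ _).aemeasurable).2 hi
  have h1 := integral_map (μ := P) (hm i (j + 1)).aemeasurable hF.aestronglyMeasurable
  rw [← h1]
  rw [hX.map_pair_succ hij] at hint ⊢
  rw [integral_comp_measure hint, integral_map (hm i j).aemeasurable
    (hF.stronglyMeasurable.integral_kernel).aestronglyMeasurable]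
  refine integral_congr_ae (.of_forall fun ω => ?_)
  simp only [Kernel.parallelComp_apply, Kernel.id_apply]
  rw [Measure.dirac_prod, integral_map measurable_prodMk_left.aemeasurable
    hF.aestronglyMeasurable]
  exact integral_const_mul (φ (X i ω)) ψ

variable {π : Measure α} [IsProbabilityMeasure π] {ε M : ℝ}

theorem IsMarkovChain.map_le_smul (hX : IsMarkovChain P K ν X) (hinv : K.Invariant π)
    (hε : 0 ≤ ε) (hε1 : ε ≤ 1) (hmin : ∀ x, ENNReal.ofReal ε • π ≤ K x) (hM : 0 ≤ M)
    (hν : ν ≤ ENNReal.ofReal (1 + M) • π) (i : ℕ) :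
    P.map (X i) ≤ ENNReal.ofReal (1 + M * (1 - ε) ^ i) • π := by
  induction i with
  | zero => simpa [hX.map_zero] using hν
  | succ i ih =>
    have : IsProbabilityMeasure (P.map (X i)) :=
      Measure.isProbabilityMeasure_map (hX.measurable i).aemeasurable
    rw [hX.map_succ, pow_succ, ← mul_assoc]
    exact comp_le_smul_of_le_smul hinv hε hε1 hmin
      (mul_nonneg hM (pow_nonneg (sub_nonneg.2 hε1) _)) ih

theorem IsMarkovChain.memLp_two_comp (hX : IsMarkovChain P K ν X) (hinv : K.Invariant π)
    (hε : 0 ≤ ε) (hε1 : ε ≤ 1) (hmin : ∀ x, ENNReal.ofReal ε • π ≤ K x) (hM : 0 ≤ M)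
    (hν : ν ≤ ENNReal.ofReal (1 + M) • π) {g : α → ℝ} (hg : MemLp g 2 π) (i : ℕ) :
    MemLp (fun ω => g (X i ω)) 2 P := by
  have h := hg.of_measure_le_smul ENNReal.ofReal_ne_top
    (hX.map_le_smul hinv hε hε1 hmin hM hν i)
  exact h.comp_of_map (hX.measurable i).aemeasurable

/-- Correlations along the chain decay geometrically. The law of `X i` enters only through its
domination by a multiple of `π`, which is applied to `|g| * |K ^ k g|`. -/
theorem IsMarkovChain.integral_mul_le (hX : IsMarkovChain P K ν X) (hinv : K.Invariant π)
    (hε : 0 ≤ ε) (hε1 : ε ≤ 1) (hmin : ∀ x, ENNReal.ofReal ε • π ≤ K x) (hM : 0 ≤ M)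
    (hν : ν ≤ ENNReal.ofReal (1 + M) • π) {g : α → ℝ} (hgm : Measurable g) (hg : MemLp g 2 π)
    (h0 : ∫ x, g x ∂π = 0) (h1 : ∫ x, g x ^ 2 ∂π ≤ 1) (i k : ℕ) :
    ∫ ω, g (X i ω) * g (X (i + k) ω) ∂P ≤ (1 + M * (1 - ε) ^ i) * (1 - ε) ^ k := by
  have hr : 0 ≤ 1 - ε := sub_nonneg.2 hε1
  have hiter := markovOp_iterate_contraction hinv hε hmin hgm hg h0
  have hL := fun {h : α → ℝ} (hh : MemLp h 2 π) => hX.memLp_two_comp hinv hε hε1 hmin hM hν hh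
  -- Conditioning on the past, `l` times, moves `l` of the `k` steps onto the function.
  have hstep : ∀ l m, l + m = k → ∫ ω, g (X i ω) * g (X (i + k) ω) ∂P =
      ∫ ω, g (X i ω) * (markovOp K)^[l] g (X (i + m) ω) ∂P := by
    intro l
    induction l with
    | zero => rintro m rfl; simp
    | succ l ih =>
      intro m hlm
      rw [ih (m + 1) (by omega), Function.iterate_succ_apply']
      exact hX.integral_mul_succ (Nat.le_add_right i m) hgm (hiter l).1
        ((hL hg i).integrable_mul (hL (hiter l).2.1 (i + m + 1)))
  obtain ⟨hkm, hkL, -, hk2⟩ := hiter k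
  have hc : 0 ≤ 1 + M * (1 - ε) ^ i := by positivity
  have hprod : Integrable (fun x => |g x * (markovOp K)^[k] g x|) π := (hg.integrable_mul hkL).abs
  rw [hstep k 0 (add_zero k), add_zero]
  calc ∫ ω, g (X i ω) * (markovOp K)^[k] g (X i ω) ∂P
      ≤ ∫ ω, |g (X i ω) * (markovOp K)^[k] g (X i ω)| ∂P :=
        (le_abs_self _).trans abs_integral_le_integral_abs
    _ = ∫ x, |g x * (markovOp K)^[k] g x| ∂(P.map (X i)) :=
        (integral_map (f := fun x => |g x * (markovOp K)^[k] g x|)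
          (hX.measurable i).aemeasurable (hgm.mul hkm).abs.aestronglyMeasurable).symm
    _ ≤ (1 + M * (1 - ε) ^ i) * ∫ x, |g x * (markovOp K)^[k] g x| ∂π :=
        integral_le_of_measure_le_smul hc (hX.map_le_smul hinv hε hε1 hmin hM hν i)
          (fun _ => abs_nonneg _) hprod
    _ ≤ (1 + M * (1 - ε) ^ i) * (1 - ε) ^ k := by
        gcongr
        refine (integral_abs_mul_le_sqrt_mul_sqrt hg hkL).trans ?_
        calc _ ≤ √1 * √(((1 - ε) ^ k) ^ 2) := by
              gcongr
              exact hk2.trans (mul_le_of_le_one_right (by positivity) h1)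
          _ = (1 - ε) ^ k := by rw [Real.sqrt_one, one_mul, Real.sqrt_sq (by positivity)]

end Chain

/-! ### The mean square error of a uniformly ergodic chain -/

theorem sum_sum_le_of_geometric_decay {ε : ℝ} (hε : 0 < ε) (hε1 : ε ≤ 1) (n : ℕ) :
    ∀ (a : ℕ → ℕ → ℝ) (c : ℕ → ℝ), (∀ i, 0 ≤ c i) → (∀ i j, a i j = a j i) →
      (∀ i k, a i (i + k) ≤ c i * (1 - ε) ^ k) →
      ∑ i ∈ Finset.range n, ∑ j ∈ Finset.range n, a i j ≤
        (2 / ε - 1) * ∑ i ∈ Finset.range n, c i := by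
  have hr : 0 ≤ 1 - ε := sub_nonneg.2 hε1
  have hgeom : ∀ m : ℕ, ∑ k ∈ Finset.range m, (1 - ε) ^ (k + 1) ≤ 1 / ε - 1 := fun m => by
    have h := Summable.sum_le_tsum (Finset.range (m + 1)) (fun k _ => pow_nonneg hr k)
      (summable_geometric_of_lt_one hr (by linarith))
    rw [tsum_geometric_of_lt_one hr (by linarith), Finset.sum_range_succ'] at h
    simp only [pow_zero, sub_sub_cancel] at h
    rw [one_div]
    linarith
  -- The row and the column of the first index are split off.
  induction n with
  | zero => simp
  | succ n ih =>
    intro a c hc hsymm ha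
    have hrow : ∑ j ∈ Finset.range n, a 0 (j + 1) ≤ c 0 * (1 / ε - 1) := by
      calc _ ≤ ∑ j ∈ Finset.range n, c 0 * (1 - ε) ^ (j + 1) := by
            gcongr with j
            simpa using ha 0 (j + 1)
        _ ≤ _ := by
            rw [← Finset.mul_sum]
            exact mul_le_mul_of_nonneg_left (hgeom n) (hc 0)
    have h00 : a 0 0 ≤ c 0 := by simpa using ha 0 0
    have hrest := ih (fun i j => a (i + 1) (j + 1)) (fun i => c (i + 1)) (fun i => hc _)
      (fun i j => hsymm _ _) fun i k => by
        have := ha (i + 1) k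
        rwa [add_right_comm] at this
    simp_rw [Finset.sum_range_succ' _ n, Finset.sum_add_distrib]
    simp_rw [hsymm _ 0]
    linear_combination hrest + 2 * hrow + h00

section Chain

variable {α Ω : Type*} [MeasurableSpace α] [MeasurableSpace Ω] {P : Measure Ω}
  [IsProbabilityMeasure P] {K : Kernel α α} [IsMarkovKernel K] {ν : Measure α} {X : ℕ → Ω → α}
  {π : Measure α} [IsProbabilityMeasure π] {ε M : ℝ}

theorem IsMarkovChain.integral_sq_sum_le (hX : IsMarkovChain P K ν X) (hinv : K.Invariant π)
    (hε : 0 < ε) (hε1 : ε ≤ 1) (hmin : ∀ x, ENNReal.ofReal ε • π ≤ K x) (hM : 0 ≤ M)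
    (hν : ν ≤ ENNReal.ofReal (1 + M) • π) {g : α → ℝ} (hgm : Measurable g) (hg : MemLp g 2 π)
    (h0 : ∫ x, g x ∂π = 0) (h1 : ∫ x, g x ^ 2 ∂π ≤ 1) (n n₀ : ℕ) :
    ∫ ω, (∑ j ∈ Finset.range n, g (X (j + n₀) ω)) ^ 2 ∂P ≤
      (2 / ε - 1) * (n + M * (1 - ε) ^ n₀ / ε) := by
  have hr : 0 ≤ 1 - ε := sub_nonneg.2 hε1
  have hL := hX.memLp_two_comp hinv hε.le hε1 hmin hM hν hg
  have hexp : ∫ ω, (∑ j ∈ Finset.range n, g (X (j + n₀) ω)) ^ 2 ∂P =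
      ∑ i ∈ Finset.range n, ∑ j ∈ Finset.range n,
        ∫ ω, g (X (i + n₀) ω) * g (X (j + n₀) ω) ∂P := by
    simp_rw [sq, Finset.sum_mul_sum]
    have hI : ∀ i j, Integrable (fun ω => g (X (i + n₀) ω) * g (X (j + n₀) ω)) P :=
      fun i j => (hL _).integrable_mul (hL _)
    rw [integral_finsetSum _ fun i _ => integrable_finsetSum _ fun j _ => hI i j]
    exact Finset.sum_congr rfl fun i _ => integral_finsetSum _ fun j _ => hI i j
  have hfac : 0 ≤ 2 / ε - 1 := by
    rw [sub_nonneg, le_div_iff₀ hε]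
    linarith
  rw [hexp]
  refine (sum_sum_le_of_geometric_decay hε hε1 n _ (fun i => 1 + M * (1 - ε) ^ (i + n₀))
    (fun i => by positivity) (fun i j => by simp_rw [mul_comm]) fun i k => ?_).trans ?_
  · have h := hX.integral_mul_le hinv hε.le hε1 hmin hM hν hgm hg h0 h1 (i + n₀) k
    rwa [add_right_comm] at h
  · refine mul_le_mul_of_nonneg_left ?_ hfac
    have hgeom : ∑ i ∈ Finset.range n, (1 - ε) ^ i ≤ 1 / ε := by
      refine (Summable.sum_le_tsum _ (fun k _ => pow_nonneg hr k)
        (summable_geometric_of_lt_one hr (by linarith))).trans_eq ?_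
      rw [tsum_geometric_of_lt_one hr (by linarith), sub_sub_cancel, one_div]
    have : ∑ i ∈ Finset.range n, (1 + M * (1 - ε) ^ (i + n₀)) =
        n + M * (1 - ε) ^ n₀ * ∑ i ∈ Finset.range n, (1 - ε) ^ i := by
      rw [Finset.sum_add_distrib, Finset.mul_sum]
      simp [pow_add, mul_comm, mul_assoc]
    rw [this, div_eq_mul_one_div (M * (1 - ε) ^ n₀)]
    gcongr

/-- The error bound for a uniformly ergodic chain: `ε` is the minorization constant, `1 + M` bounds
the density of the initial distribution with respect to `π`, and `n₀` is the burn-in. -/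
theorem IsMarkovChain.meanSquareError_le (hX : IsMarkovChain P K ν X) (hinv : K.Invariant π)
    (hε : 0 < ε) (hε1 : ε ≤ 1) (hmin : ∀ x, ENNReal.ofReal ε • π ≤ K x) (hM : 0 ≤ M)
    (hν : ν ≤ ENNReal.ofReal (1 + M) • π) {f : α → ℝ} (hf : MemLp f 2 π)
    (hf1 : eLpNorm f 2 π ≤ 1) {n : ℕ} (hn : 0 < n) (n₀ : ℕ) :
    meanSquareError P X π f n n₀ ≤
      ENNReal.ofReal ((2 / ε - 1) * (n + M * (1 - ε) ^ n₀ / ε) / (n : ℝ) ^ 2) := by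
  have hn' : (n : ℝ) ≠ 0 := by positivity
  have hsq1 : ∫ x, f x ^ 2 ∂π ≤ 1 := by
    have h := hf.eLpNorm_eq_integral_rpow_norm two_ne_zero ENNReal.ofNat_ne_top
    rw [h] at hf1
    have h2 := ENNReal.ofReal_le_one.1 hf1
    simp only [ENNReal.toReal_ofNat, Real.rpow_two, Real.norm_eq_abs, sq_abs] at h2
    by_contra! hlt
    exact absurd h2 (not_le.2 (Real.one_lt_rpow hlt (by norm_num)))
  set a := ∫ x, f x ∂π
  -- A measurable version of the centred function; the chain does not see the difference.
  set f' := hf.1.mk f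
  have hff' : f =ᵐ[π] f' := hf.1.ae_eq_mk
  have hfm : Measurable f' := hf.1.stronglyMeasurable_mk.measurable
  have hfL : MemLp f' 2 π := hf.ae_eq hff'
  have hfa : ∫ x, f' x ∂π = a := (integral_congr_ae hff').symm
  have hfsq : ∫ x, f' x ^ 2 ∂π ≤ 1 := by
    refine (integral_congr_ae ?_).symm.trans_le hsq1
    exact hff'.fun_comp (· ^ 2)
  set g : α → ℝ := fun x => f' x - a with hg
  have hgm : Measurable g := hfm.sub_const a
  have hgL : MemLp g 2 π := hfL.sub (memLp_const a)
  have hfi := hfL.integrable one_le_two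
  have h0 : ∫ x, g x ∂π = 0 := by
    rw [integral_sub hfi (integrable_const a), hfa]
    simp
  have h1 : ∫ x, g x ^ 2 ∂π ≤ 1 := by
    have : ∀ x, g x ^ 2 = f' x ^ 2 - 2 * a * f' x + a ^ 2 := fun x => by simp only [hg]; ring
    simp_rw [this]
    rw [integral_add (f := fun x => f' x ^ 2 - 2 * a * f' x) (g := fun _ => a ^ 2)
      (hfL.integrable_sq.sub (hfi.const_mul _)) (integrable_const _),
      integral_sub hfL.integrable_sq (hfi.const_mul _), integral_const_mul, hfa]
    simp only [integral_const, probReal_univ, one_smul]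
    nlinarith [sq_nonneg a]
  have hae : ∀ i, ∀ᵐ ω ∂P, f (X i ω) = f' (X i ω) := fun i => by
    refine ae_of_ae_map (p := fun x => f x = f' x) (hX.measurable i).aemeasurable ?_
    exact (Measure.absolutelyContinuous_of_le_smul
      (hX.map_le_smul hinv hε.le hε1 hmin hM hν i)).ae_le hff'
  have hpt : ∀ᵐ ω ∂P, |estimator X f n n₀ ω - a| ^ 2 =
      (∑ j ∈ Finset.range n, g (X (j + n₀) ω)) ^ 2 / (n : ℝ) ^ 2 := by
    filter_upwards [ae_all_iff.2 hae] with ω hω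
    rw [sq_abs, ← div_pow, estimator]
    simp only [hg, hω, Finset.sum_sub_distrib, Finset.sum_const, Finset.card_range, nsmul_eq_mul]
    congr 1
    field_simp
  have hint : Integrable
      (fun ω => (∑ j ∈ Finset.range n, g (X (j + n₀) ω)) ^ 2 / (n : ℝ) ^ 2) P :=
    (memLp_finsetSum _ fun j _ =>
      hX.memLp_two_comp hinv hε.le hε1 hmin hM hν hgL (j + n₀)).integrable_sq.div_const _
  rw [meanSquareError, lintegral_congr_ae (hpt.mono fun ω h => congrArg ENNReal.ofReal h),
    ← ofReal_integral_eq_lintegral_ofReal hint (.of_forall fun ω => by positivity),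
    integral_div]
  gcongr
  exact hX.integral_sq_sum_le hinv hε hε1 hmin hM hν hgm hgL h0 h1 n n₀

end Chain

/-! ### The independent Metropolis kernel -/

section Metropolis

variable {α : Type*} [MeasurableSpace α] {μ : Measure α} [IsProbabilityMeasure μ] {ρ : α → ℝ}

theorem metropolisKernel_apply {Q : Kernel α α} [IsSFiniteKernel Q] (hρ : Measurable ρ) (x : α) :
    metropolisKernel Q ρ hρ x = (Q x).withDensity (fun y => ENNReal.ofReal (acceptance ρ x y)) +
      (1 - ∫⁻ y, ENNReal.ofReal (acceptance ρ x y) ∂(Q x)) • Measure.dirac x := rfl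

theorem lintegral_acceptance_le_one {μ : Measure α} [IsProbabilityMeasure μ] (x : α) :
    ∫⁻ y, ENNReal.ofReal (acceptance ρ x y) ∂μ ≤ 1 :=
  (lintegral_mono (g := fun _ => 1) fun y => by
    simp [acceptance]).trans_eq (by simp)

theorem isMarkovKernel_metropolisKernel (Q : Kernel α α) [IsMarkovKernel Q] (hρ : Measurable ρ) :
    IsMarkovKernel (metropolisKernel Q ρ hρ) where
  isProbabilityMeasure x := ⟨by
    rw [metropolisKernel_apply, Measure.add_apply, Measure.smul_apply, smul_eq_mul,
      withDensity_apply _ MeasurableSet.univ, Measure.restrict_univ, measure_univ, mul_one]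
    exact add_tsub_cancel_of_le (lintegral_acceptance_le_one x)⟩

/-- The unnormalized flow `ρ x * α(x, y) = min (ρ x) (ρ y)` is symmetric. -/
theorem ofReal_mul_acceptance_comm {α : Type*} {ρ : α → ℝ} (hρ0 : ∀ x, 0 < ρ x) (x y : α) :
    ENNReal.ofReal (ρ x) * ENNReal.ofReal (acceptance ρ x y) =
      ENNReal.ofReal (ρ y) * ENNReal.ofReal (acceptance ρ y x) := by
  have h : ∀ x y, ρ x * acceptance ρ x y = min (ρ x) (ρ y) := fun x y => by
    rw [acceptance, mul_min_of_nonneg _ _ (hρ0 x).le, mul_one, mul_div_cancel₀ _ (hρ0 x).ne']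
  rw [← ENNReal.ofReal_mul (hρ0 x).le, ← ENNReal.ofReal_mul (hρ0 y).le, h, h, min_comm]

theorem isReversible_metropolisKernel_const (hρ : Measurable ρ) (hρ0 : ∀ x, 0 < ρ x) :
    (metropolisKernel (Kernel.const α μ) ρ hρ).IsReversible
      (μ.withDensity fun x => ENNReal.ofReal (ρ x)) := by
  intro A B hA hB
  have hρm : Measurable fun x => ENNReal.ofReal (ρ x) := hρ.ennreal_ofReal
  have hacc := measurable_acceptance hρ
  have hacc' : Measurable fun x => ∫⁻ y, ENNReal.ofReal (acceptance ρ x y) ∂μ :=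
    hacc.lintegral_prod_right'
  have hacc1 : ∀ x, Measurable fun y => ENNReal.ofReal (acceptance ρ x y) :=
    fun x => hacc.comp measurable_prodMk_left
  have hrej : Measurable fun x =>
      ENNReal.ofReal (ρ x) * (1 - ∫⁻ y, ENNReal.ofReal (acceptance ρ x y) ∂μ) :=
    hρm.mul (measurable_const.sub hacc')
  -- The flow from `A` to `B` is a proposal part and a rejection part, each symmetric.
  have hflow : ∀ A B, MeasurableSet A → MeasurableSet B →
      ∫⁻ x in A, metropolisKernel (Kernel.const α μ) ρ hρ x B
          ∂(μ.withDensity fun x => ENNReal.ofReal (ρ x)) =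
        ∫⁻ x in A, ∫⁻ y in B, ENNReal.ofReal (ρ x) * ENNReal.ofReal (acceptance ρ x y) ∂μ ∂μ +
        ∫⁻ x in A ∩ B, ENNReal.ofReal (ρ x) *
          (1 - ∫⁻ y, ENNReal.ofReal (acceptance ρ x y) ∂μ) ∂μ := by
    intro A B hA hB
    rw [restrict_withDensity hA, lintegral_withDensity_eq_lintegral_mul _ hρm
      (Kernel.measurable_coe _ hB)]
    have : ∀ x, ((fun x => ENNReal.ofReal (ρ x)) * fun x =>
        metropolisKernel (Kernel.const α μ) ρ hρ x B) x =
        ∫⁻ y in B, ENNReal.ofReal (ρ x) * ENNReal.ofReal (acceptance ρ x y) ∂μ +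
        B.indicator (fun x => ENNReal.ofReal (ρ x) *
          (1 - ∫⁻ y, ENNReal.ofReal (acceptance ρ x y) ∂μ)) x := fun x => by
      rw [Pi.mul_apply, metropolisKernel_apply, Measure.add_apply, Measure.smul_apply, smul_eq_mul,
        Kernel.const_apply, withDensity_apply _ hB, Measure.dirac_apply' _ hB, mul_add,
        lintegral_const_mul _ (hacc1 x)]
      by_cases hx : x ∈ B <;> simp [hx]
    rw [lintegral_congr this, lintegral_add_right _ (hrej.indicator hB), setLIntegral_indicator hB,
      Set.inter_comm B A]
  rw [hflow A B hA hB, hflow B A hB hA, Set.inter_comm B A]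
  congr 1
  rw [lintegral_lintegral_swap]
  · simp_rw [ofReal_mul_acceptance_comm hρ0]
  · exact ((hρm.comp measurable_fst).mul hacc).aemeasurable

variable {C : ℝ}

theorem lintegral_ofReal_mem_Icc (hρC : ∀ x, 1 ≤ ρ x ∧ ρ x ≤ C) :
    1 ≤ ∫⁻ x, ENNReal.ofReal (ρ x) ∂μ ∧ ∫⁻ x, ENNReal.ofReal (ρ x) ∂μ ≤ ENNReal.ofReal C := by
  constructor
  · calc (1 : ENNReal) = ∫⁻ _, 1 ∂μ := by simp
      _ ≤ _ := lintegral_mono fun x => ENNReal.one_le_ofReal.2 (hρC x).1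
  · calc _ ≤ ∫⁻ _, ENNReal.ofReal C ∂μ := lintegral_mono fun x => ENNReal.ofReal_le_ofReal (hρC x).2
      _ = _ := by simp

theorem minorization_metropolisKernel_const (hρ : Measurable ρ) (hρC : ∀ x, 1 ≤ ρ x ∧ ρ x ≤ C)
    (x : α) :
    ENNReal.ofReal (1 / C) • ((∫⁻ x, ENNReal.ofReal (ρ x) ∂μ)⁻¹ •
        μ.withDensity fun x => ENNReal.ofReal (ρ x)) ≤
      metropolisKernel (Kernel.const α μ) ρ hρ x := by
  have hC : 1 ≤ C := (hρC x).1.trans (hρC x).2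
  have hZ : (∫⁻ x, ENNReal.ofReal (ρ x) ∂μ)⁻¹ ≤ 1 :=
    ENNReal.inv_le_one.2 (lintegral_ofReal_mem_Icc hρC).1
  rw [metropolisKernel_apply, Kernel.const_apply]
  refine le_trans ?_ (Measure.le_add_right le_rfl)
  calc _ ≤ ENNReal.ofReal (1 / C) • μ.withDensity (fun x => ENNReal.ofReal (ρ x)) := by
        rw [smul_smul]
        refine Measure.le_iff.2 fun A _ => ?_
        simp only [Measure.smul_apply, smul_eq_mul]
        gcongr
        exact mul_le_of_le_one_right' hZ
    _ = μ.withDensity (ENNReal.ofReal (1 / C) • fun x => ENNReal.ofReal (ρ x)) :=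
        (withDensity_smul _ hρ.ennreal_ofReal).symm
    _ ≤ _ := by
        refine withDensity_mono (.of_forall fun y => ?_)
        simp only [Pi.smul_apply, smul_eq_mul]
        rw [← ENNReal.ofReal_mul (by positivity)]
        refine ENNReal.ofReal_le_ofReal (le_min ?_ ?_)
        · rw [one_div_mul_eq_div]
          exact div_le_one_of_le₀ (hρC y).2 (by linarith)
        · rw [one_div_mul_eq_div]
          exact div_le_div_of_nonneg_left (by linarith [(hρC y).1]) (by linarith [(hρC x).1])
            (hρC x).2

theorem le_smul_withDensity (hρC : ∀ x, 1 ≤ ρ x ∧ ρ x ≤ C) :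
    μ ≤ ENNReal.ofReal C • ((∫⁻ x, ENNReal.ofReal (ρ x) ∂μ)⁻¹ •
      μ.withDensity fun x => ENNReal.ofReal (ρ x)) := by
  obtain ⟨hZ1, hZC⟩ := lintegral_ofReal_mem_Icc (μ := μ) hρC
  set Z := ∫⁻ x, ENNReal.ofReal (ρ x) ∂μ
  have h1 : (1 : ENNReal) ≤ ENNReal.ofReal C * Z⁻¹ := by
    rw [← ENNReal.mul_inv_cancel (a := Z) (zero_lt_one.trans_le hZ1).ne'
      (hZC.trans_lt ENNReal.ofReal_lt_top).ne]
    gcongr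
  have h2 : μ ≤ μ.withDensity fun x => ENNReal.ofReal (ρ x) := by
    conv_lhs => rw [← withDensity_one (μ := μ)]
    exact withDensity_mono (.of_forall fun x => ENNReal.one_le_ofReal.2 (hρC x).1)
  rw [smul_smul]
  refine Measure.le_iff.2 fun A _ => ?_
  simp only [Measure.smul_apply, smul_eq_mul]
  exact (h2 A).trans (le_mul_of_one_le_left' h1)

end Metropolis

/-! ### The uniform distribution on a subset of Euclidean space -/

section Euclidean

variable {d : ℕ} {G : Set (EuclideanSpace ℝ (Fin d))}

theorem lebesgueOn_univ (hG : MeasurableSet G) : lebesgueOn G Set.univ = volume G := by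
  rw [lebesgueOn, Measure.comap_apply _ Subtype.val_injective
    (fun s hs => hG.subtype_image hs) _ MeasurableSet.univ]
  simp

theorem isProbabilityMeasure_uniformMeasure (hG : MeasurableSet G) (h0 : volume G ≠ 0)
    (htop : volume G ≠ ⊤) : IsProbabilityMeasure (uniformMeasure G) := ⟨by
  rw [uniformMeasure, Measure.smul_apply, lebesgueOn_univ hG, smul_eq_mul,
    ENNReal.inv_mul_cancel h0 htop]⟩

/-- The normalization of the reference measure cancels in the target measure. -/
theorem targetMeasure_eq (h0 : volume G ≠ 0) (htop : volume G ≠ ⊤) (ρ : G → ℝ) :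
    targetMeasure G ρ = (∫⁻ x, ENNReal.ofReal (ρ x) ∂(uniformMeasure G))⁻¹ •
      (uniformMeasure G).withDensity fun x => ENNReal.ofReal (ρ x) := by
  rw [targetMeasure, uniformMeasure, lintegral_smul_measure, withDensity_smul_measure, smul_smul,
    smul_eq_mul, ENNReal.mul_inv (.inl (ENNReal.inv_ne_zero.2 htop))
    (.inl (ENNReal.inv_ne_top.2 h0)), inv_inv, mul_right_comm, ENNReal.mul_inv_cancel h0 htop,
    one_mul]

end Euclidean

end MCMC

/-! ### The error of the Metropolis algorithm -/

theorem mainTheorem3 {d : ℕ} (G : Set (EuclideanSpace ℝ (Fin d))) (hG : MeasurableSet G)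
    (hGb : Bornology.IsBounded G) (hvol : 1 ≤ volume.real G)
    (C : ℝ) (hC : 1 ≤ C) (n : ℕ) (hn : 0 < n)
    (ρ : G → ℝ) (hρ : Measurable ρ) (hρC : ∀ x, 1 ≤ ρ x ∧ ρ x ≤ C)
    (f : G → ℝ) (hf : MemLp f 2 (MCMC.targetMeasure G ρ))
    (hf1 : eLpNorm f 2 (MCMC.targetMeasure G ρ) ≤ 1)
    {Ω : Type*} [MeasurableSpace Ω] (P : Measure Ω) [IsProbabilityMeasure P] (X : ℕ → Ω → G)
    (hX : MCMC.IsMarkovChain P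
      (MCMC.metropolisKernel (Kernel.const G (MCMC.uniformMeasure G)) ρ hρ)
      (MCMC.uniformMeasure G) X) :
    MCMC.meanSquareError P X (MCMC.targetMeasure G ρ) f n
        ⌈C * volume.real G * Real.log (2 * C)⌉₊ ≤
      ENNReal.ofReal (2 * C * volume.real G / n +
        4 * C ^ 2 * volume.real G ^ 2 / (n : ℝ) ^ 2) := by
  have h0 : volume G ≠ 0 := fun h => by
    rw [measureReal_def, h, ENNReal.toReal_zero] at hvol
    linarith
  have htop : volume G ≠ ⊤ := hGb.measure_lt_top.ne
  have hC0 : 0 < C := by linarith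
  set V := volume.real G
  set n₀ := ⌈C * V * Real.log (2 * C)⌉₊
  have := MCMC.isProbabilityMeasure_uniformMeasure hG h0 htop
  have := MCMC.isMarkovKernel_metropolisKernel (Kernel.const G (MCMC.uniformMeasure G)) hρ
  obtain ⟨hZ1, hZC⟩ := MCMC.lintegral_ofReal_mem_Icc (μ := MCMC.uniformMeasure G) hρC
  have hZ0 := (zero_lt_one.trans_le hZ1).ne'
  have hZtop := (hZC.trans_lt ENNReal.ofReal_lt_top).ne
  have hπ := MCMC.targetMeasure_eq h0 htop ρ
  have : IsProbabilityMeasure (MCMC.targetMeasure G ρ) := ⟨by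
    rw [hπ, Measure.smul_apply, withDensity_apply _ MeasurableSet.univ, Measure.restrict_univ,
      smul_eq_mul, ENNReal.inv_mul_cancel hZ0 hZtop]⟩
  have hinv : (MCMC.metropolisKernel (Kernel.const G (MCMC.uniformMeasure G)) ρ hρ).Invariant
      (MCMC.targetMeasure G ρ) := by
    have h := (MCMC.isReversible_metropolisKernel_const (μ := MCMC.uniformMeasure G) hρ
      fun x => zero_lt_one.trans_le (hρC x).1).invariant
    rw [Kernel.Invariant, hπ, Measure.bind_smul, h.def]
  have hmin := MCMC.minorization_metropolisKernel_const (μ := MCMC.uniformMeasure G) hρ hρC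
  have hle := MCMC.le_smul_withDensity (μ := MCMC.uniformMeasure G) hρC
  rw [← hπ] at hle
  simp_rw [← hπ] at hmin
  have hε1 : 1 / C ≤ 1 := by
    rw [div_le_one hC0]
    exact hC
  refine (hX.meanSquareError_le hinv (ε := 1 / C) (M := C - 1) (by positivity) hε1 hmin
    (by linarith) (by rwa [add_sub_cancel]) hf hf1 hn n₀).trans (ENNReal.ofReal_le_ofReal ?_)
  have hn' : (0 : ℝ) < n := by positivity
  -- `n₀ ≥ C * log (2 * C)` steps bring the contraction factor down to `1 / (2 * C)`, so the law of
  -- the chain after the burn-in is at most `3 / 2` times the target.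
  have hδ : (1 - 1 / C) ^ n₀ ≤ 1 / (2 * C) := by
    have hlog : 0 ≤ Real.log (2 * C) := Real.log_nonneg (by linarith)
    have hn₀ : Real.log (2 * C) ≤ n₀ / C := by
      rw [le_div_iff₀ hC0]
      calc Real.log (2 * C) * C ≤ C * V * Real.log (2 * C) := by
            nlinarith [mul_nonneg (mul_nonneg hC0.le hlog) (sub_nonneg.2 hvol)]
        _ ≤ n₀ := Nat.le_ceil _
    calc (1 - 1 / C) ^ n₀ ≤ Real.exp (-(1 / C)) ^ n₀ := by
          gcongr
          exact Real.one_sub_le_exp_neg _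
      _ = Real.exp (-(n₀ / C)) := by
          rw [← Real.exp_nat_mul]
          congr 1
          ring
      _ ≤ Real.exp (-Real.log (2 * C)) := Real.exp_le_exp.2 (neg_le_neg hn₀)
      _ = 1 / (2 * C) := by rw [Real.exp_neg, Real.exp_log (by positivity), one_div]
  have hδ0 : 0 ≤ (1 - 1 / C) ^ n₀ := pow_nonneg (by linarith) _
  have hMδ : (C - 1) * (1 - 1 / C) ^ n₀ / (1 / C) ≤ C / 2 := by
    calc (C - 1) * (1 - 1 / C) ^ n₀ / (1 / C) ≤ C * (1 / (2 * C)) / (1 / C) := by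
          gcongr
          linarith
      _ = C / 2 := by field_simp
  calc (2 / (1 / C) - 1) * (n + (C - 1) * (1 - 1 / C) ^ n₀ / (1 / C)) / (n : ℝ) ^ 2
      ≤ (2 * C) * (n + C / 2) / (n : ℝ) ^ 2 := by
        have hMδ0 : 0 ≤ (C - 1) * (1 - 1 / C) ^ n₀ / (1 / C) :=
          div_nonneg (mul_nonneg (by linarith) hδ0) (by positivity)
        have : 2 / (1 / C) - 1 ≤ 2 * C := by
          rw [div_div_eq_mul_div, div_one]
          linarith
        gcongr
    _ = 2 * C * 1 / n + C ^ 2 * 1 ^ 2 / (n : ℝ) ^ 2 := by field_simp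
    _ ≤ 2 * C * V / n + 4 * C ^ 2 * V ^ 2 / (n : ℝ) ^ 2 := by
        gcongr
        linarith [sq_nonneg C]
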